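/- Let $\alpha,\beta\in[0,1]$ with $\beta<1$. Consider the Markov chain $(X_t)_{t\ge 0}$ on configurations $\{\ominus,\oplus\}^{\mathbb Z}$ in which, at each step, all sites are updated simultaneously and independently, and a site $k$ becomes $\oplus$ with probability $0$, $\beta$, $\alpha$, $1$ according as the current states of the sites $(k,k+1)$ are $\ominus\ominus$, $\oplus\ominus$, $\ominus\oplus$, $\oplus\oplus$ (and becomes $\ominus$ otherwise). Write $F$ for its transition operator, so that $X_t$ has law $\mu F^t$ if $X_0$ has law $\mu$. An island of pluses is a configuration with only finitely many $\oplus$; its length is the number of sites from its leftmost to its rightmost $\oplus$ (and $0$ if there is no $\oplus$). An archipelago of pluses is a probability measure $\mu$ concentrated on the (countable) set of islands of pluses; its giant is the greatest length of an island that has positive $\mu$-mass ($\infty$ if these lengths are unbounded). Let $\mu$ be an archipelago of pluses with finite giant, let $X_0$ have law $\mu$, and let $\tau_\mu=\inf\{t\ge 0: X_t \text{ is ``all minuses'' or ``all pluses''}\}$, with $\inf\emptyset=\infty$. Then almost surely $\tau_\mu$ is the first time at which $X_t$ is ``all minuses'', and (A) if $\alpha<1-\beta$, then $\mathbb E(\tau_\mu)<\infty$;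 (B) if $\alpha\ge 1-\beta$ and $\mu$ is not the point mass at ``all minuses'', then $\mathbb E(\tau_\mu)=\infty$. -/

import Mathlib

open MeasureTheory ProbabilityTheory
open scoped ENNReal

namespace Archipelago

/-- Configurations on `ℤ` with two states per site: `true` is plus, `false` is minus.
The σ-algebra is the product one, i.e. the one generated by the cylinders. -/
abbrev Config : Type := ℤ → Bool

/-- The configuration "all minuses". -/
def allMinus : Config := fun _ => false

/-- The configuration "all pluses". -/
def allPlus : Config := fun _ => true

/-- `theta α β a b` is the probability that a site becomes plus when its own state is `a`
and the state of its right neighbour is `b`. -/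
def theta (α β : unitInterval) : Bool → Bool → unitInterval
  | false, false => 0
  | true, false => β
  | false, true => α
  | true, true => 1

/-- The law of the state of site `k` after one step from the configuration `x`:
plus with probability `theta α β (x k) (x (k + 1))`, minus otherwise. -/
noncomputable def siteLaw (α β : unitInterval) (x : Config) (k : ℤ) : Measure Bool :=
  bernoulliMeasure true false (theta α β (x k) (x (k + 1)))

instance (α β : unitInterval) (x : Config) (k : ℤ) :
    IsProbabilityMeasure (siteLaw α β x k) := by
  unfold siteLaw; infer_instance

theorem measurable_siteLaw_apply (α β : unitInterval) (k : ℤ) (t : Set Bool) :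
    Measurable fun x : Config => siteLaw α β x k t := by
  have hf : ∀ g : Bool → Bool → ℝ≥0∞, Measurable fun x : Config => g (x k) (x (k + 1)) := by
    intro g
    have hg : Measurable (Function.uncurry g) := measurable_of_finite _
    have hp : Measurable fun x : Config => (x k, x (k + 1)) := by fun_prop
    exact hg.comp hp
  exact hf fun a b => bernoulliMeasure true false (theta α β a b) t

theorem stepLaw_pi (α β : unitInterval) (x : Config) (s : Finset ℤ) (t : ℤ → Set Bool) :
    Measure.infinitePi (siteLaw α β x) ((s : Set ℤ).pi t) = ∏ i ∈ s, siteLaw α β x i (t i) :=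
  Measure.infinitePi_pi _ fun _ _ => MeasurableSet.of_discrete

theorem measurable_stepLaw (α β : unitInterval) :
    Measurable fun x : Config => Measure.infinitePi (siteLaw α β x) := by
  refine Measurable.measure_of_isPiSystem_of_isProbabilityMeasure
    generateFrom_squareCylinders.symm
    (isPiSystem_squareCylinders (fun _ => MeasurableSpace.isPiSystem_measurableSet)
      (by simp)) ?_
  rintro _ ⟨s, t, -, rfl⟩
  simp only [stepLaw_pi]
  exact Finset.measurable_fun_prod s fun i _ => measurable_siteLaw_apply α β i (t i)

/-- The probabilistic cellular automaton `F`, as a Markov kernel: given the current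
configuration, all sites are updated simultaneously and independently. -/
noncomputable def F (α β : unitInterval) : Kernel Config Config where
  toFun x := Measure.infinitePi (siteLaw α β x)
  measurable' := measurable_stepLaw α β

instance (α β : unitInterval) : IsMarkovKernel (F α β) :=
  ⟨fun x => by
    change IsProbabilityMeasure (Measure.infinitePi (siteLaw α β x))
    infer_instance⟩

/-- The law, on sequences of configurations, of the Markov chain `ω 0, ω 1, …` with initial
distribution `μ` and transition kernel `F α β`; the law of `ω t` is `μ F ^ t`. -/
noncomputable def processLaw (α β : unitInterval) (μ : Measure Config) :
    Measure (ℕ → Config) :=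
  Kernel.trajMeasure (X := fun _ => Config) μ fun n =>
    (F α β).comap (fun h : (Finset.Iic n) → Config => h ⟨n, Finset.mem_Iic.2 le_rfl⟩)
      (measurable_pi_apply _)

/-- The first time at which the sequence `ω` is in `S`; it is `∞` if there is none. -/
noncomputable def hittingTime (S : Set Config) (ω : ℕ → Config) : ℝ≥0∞ :=
  ⨅ (t : ℕ) (_ : ω t ∈ S), (t : ℝ≥0∞)

/-- The absorption time. The point mass at a configuration is of the form
`(1 - lam) δ_allMinus + lam δ_allPlus` exactly if the configuration is `allMinus` or `allPlus`. -/
noncomputable def tau : (ℕ → Config) → ℝ≥0∞ := hittingTime {allMinus, allPlus}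

/-- The expectation of the absorption time of the process started from `μ`. -/
noncomputable def expectedTau (α β : unitInterval) (μ : Measure Config) : ℝ≥0∞ :=
  ∫⁻ ω, tau ω ∂(processLaw α β μ)

/-- The islands of pluses: configurations that differ from "all minuses" at finitely many
sites. -/
def islandsOfPluses : Set Config := {x | {i : ℤ | x i ≠ allMinus i}.Finite}

/-- The length of an island of pluses: the number of sites from its leftmost plus to its
rightmost plus (and `0` for "all minuses"). -/
noncomputable def length (x : Config) : ℕ∞ :=
  ⨆ (k : ℤ) (l : ℤ) (_ : x k = true) (_ : x l = true), ((l - k + 1).toNat : ℕ∞)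

/-- Archipelagos of pluses: probability measures concentrated on the islands of pluses. -/
def IsArchipelagoOfPluses (μ : Measure Config) : Prop :=
  IsProbabilityMeasure μ ∧ μ islandsOfPluses = 1

/-- The giant of an archipelago of pluses: the greatest length of an island that carries
positive mass, `∞` if these lengths are unbounded. -/
noncomputable def giant (μ : Measure Config) : ℕ∞ :=
  ⨆ (x : Config) (_ : x ∈ islandsOfPluses) (_ : 0 < μ {x}), length x

end Archipelago

open Archipelago

namespace Archipelago

/-! The number of pluses is a Lyapunov function. Let every plus pass mass `α` to its left neighbour
and keep `1 - α`. Site by site, the result equals the probability of a plus after one step, except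
at a right end `⊕⊖`, where that probability is `β` instead of `1 - α`. The mean count thus changes
by `α + β - 1` per right end.

A finite nonempty set of pluses has a right end. If `α + β < 1`, the mean count therefore drops by
at least `(1 - α - β) P(X_t ≠ allMinus)` at step `t`; as it starts finite and stays nonnegative,
these probabilities have a finite sum, which bounds the mean of `tau`.

If `α + β ≥ 1`, the mean count never decreases. Pluses spread by at most one site per step, to the
left, so the count is at most `n + t`. Hence `P(X_t ≠ allMinus)` is at least a constant over `n + 1
+ t`, and the harmonic series diverges. The same bound on the spread rules out `allPlus`. -/

/-! ### One-step and initial laws of the chain -/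

instance (α β : unitInterval) (μ : Measure Config) [IsProbabilityMeasure μ] :
    IsProbabilityMeasure (processLaw α β μ) := by
  unfold processLaw; infer_instance

/-- Under `processLaw α β μ`, the state at time `t + 1` is distributed according to
`F α β` applied to the state at time `t`. -/
theorem lintegral_consecutive (α β : unitInterval) (μ : Measure Config) [IsProbabilityMeasure μ]
    (t : ℕ) {g : Config × Config → ℝ≥0∞} (hg : Measurable g) :
    ∫⁻ ω, g (ω t, ω (t + 1)) ∂(processLaw α β μ) =
      ∫⁻ ω, ∫⁻ y, g (ω t, y) ∂(F α β (ω t)) ∂(processLaw α β μ) := by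
  have key := Kernel.map_frestrictLe_trajMeasure_compProd_eq_map_trajMeasure
    (X := fun _ => Config) (μ₀ := μ)
    (κ := fun n => (F α β).comap
      (fun h : (Finset.Iic n) → Config => h ⟨n, Finset.mem_Iic.2 le_rfl⟩)
      (measurable_pi_apply _)) (a := t)
  let G : ((Finset.Iic t) → Config) × Config → ℝ≥0∞ :=
    fun p => g (p.1 ⟨t, Finset.mem_Iic.2 le_rfl⟩, p.2)
  have hG : Measurable G := by fun_prop
  have hr : Measurable (Preorder.frestrictLe (π := fun _ => Config) t) := by fun_prop
  have h := congrArg (fun ν => ∫⁻ p, G p ∂ν) key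
  have hpair : Measurable fun ω : ℕ → Config =>
      (Preorder.frestrictLe (π := fun _ => Config) t ω, ω (t + 1)) := by fun_prop
  rw [lintegral_map hG hpair, Measure.lintegral_compProd hG,
    lintegral_map (Measurable.lintegral_kernel_prod_right' hG) hr] at h
  exact h.symm

theorem processLaw_map_zero (α β : unitInterval) (μ : Measure Config) [IsProbabilityMeasure μ] :
    (processLaw α β μ).map (fun ω => ω 0) = μ := by
  unfold processLaw Kernel.trajMeasure
  have h : (fun ω : ℕ → Config => ω 0) =
      (MeasurableEquiv.piUnique (fun _ : Finset.Iic 0 => Config)) ∘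
        Preorder.frestrictLe (π := fun _ => Config) 0 := by
    funext ω; rfl
  rw [h, ← Measure.map_map (by fun_prop) (by fun_prop), Measure.map_comp _ _ (by fun_prop),
    Kernel.traj_map_frestrictLe, Kernel.partialTraj_self, Measure.id_comp,
    Measure.map_map (by fun_prop) (by fun_prop)]
  exact (congrArg (Measure.map · μ) (MeasurableEquiv.self_comp_symm _)).trans Measure.map_id

theorem ae_zero_of_ae (α β : unitInterval) {μ : Measure Config} [IsProbabilityMeasure μ]
    {p : Config → Prop} (h : ∀ᵐ x ∂μ, p x) : ∀ᵐ ω ∂(processLaw α β μ), p (ω 0) := by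
  rw [← processLaw_map_zero α β μ] at h
  exact ae_of_ae_map (measurable_pi_apply 0).aemeasurable h

theorem F_apply_plus (α β : unitInterval) (x : Config) (k : ℤ) :
    F α β x {y | y k = true} = ENNReal.ofReal (theta α β (x k) (x (k + 1)) : ℝ) := by
  have h : {y : Config | y k = true} = (({k} : Finset ℤ) : Set ℤ).pi fun _ => {true} := by
    ext y; simp
  change Measure.infinitePi (siteLaw α β x) _ = _
  rw [h, stepLaw_pi, Finset.prod_singleton, siteLaw,
    bernoulliMeasure_apply_of_mem_of_notMem _ (by measurability) (by simp) (by simp)]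
  rw [ENNReal.ofReal, Real.toNNReal_of_nonneg (theta α β (x k) (x (k + 1))).2.1]
  rfl

theorem measurableSet_plus (k : ℤ) : MeasurableSet {y : Config | y k = true} :=
  measurableSet_eq_fun (measurable_pi_apply k) measurable_const

/-- Almost surely, no site becomes plus when it and its right neighbour are minus. -/
theorem ae_no_spontaneous_birth (α β : unitInterval) (μ : Measure Config)
    [IsProbabilityMeasure μ] :
    ∀ᵐ ω ∂(processLaw α β μ), ∀ (t : ℕ) (k : ℤ), ω t k = false → ω t (k + 1) = false →
      ω (t + 1) k = false := by
  rw [ae_all_iff]; intro t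
  rw [ae_all_iff]; intro k
  -- The forbidden transitions at `k`: each has probability `theta _ _ false false = 0` given the
  -- present.
  let B : Set (Config × Config) := {p | p.1 k = false ∧ p.1 (k + 1) = false ∧ p.2 k = true}
  have hB : MeasurableSet B := by
    have h1 : Measurable fun p : Config × Config => p.1 k := by fun_prop
    have h2 : Measurable fun p : Config × Config => p.1 (k + 1) := by fun_prop
    have h3 : Measurable fun p : Config × Config => p.2 k := by fun_prop
    exact (measurableSet_eq_fun h1 measurable_const).inter
      ((measurableSet_eq_fun h2 measurable_const).inter
        (measurableSet_eq_fun h3 measurable_const))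
  have hm : Measurable (B.indicator (1 : Config × Config → ℝ≥0∞)) := measurable_one.indicator hB
  have h := lintegral_consecutive α β μ t hm
  have hz : ∀ ω : ℕ → Config,
      ∫⁻ y, B.indicator (1 : Config × Config → ℝ≥0∞) (ω t, y) ∂(F α β (ω t)) = 0 := by
    intro ω
    by_cases hω : ω t k = false ∧ ω t (k + 1) = false
    · have : (fun y => B.indicator (1 : Config × Config → ℝ≥0∞) (ω t, y)) =
          {y : Config | y k = true}.indicator 1 := by
        funext y
        simp [B, Set.indicator, hω]
      rw [this, lintegral_indicator_one (measurableSet_plus k), F_apply_plus]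
      simp [hω.1, hω.2, theta]
    · have : (fun y => B.indicator (1 : Config × Config → ℝ≥0∞) (ω t, y)) = 0 := by
        funext y
        exact Set.indicator_of_notMem (fun hc => hω ⟨hc.1, hc.2.1⟩) _
      rw [this]; exact lintegral_zero
  simp only [hz, lintegral_zero] at h
  rw [lintegral_eq_zero_iff (by fun_prop)] at h
  filter_upwards [h] with ω hω h1 h2
  by_contra h3
  have : (ω t, ω (t + 1)) ∈ B := ⟨h1, h2, by simpa using h3⟩
  simp [Set.indicator_of_mem this] at hω

/-! ### The number of pluses and its drift -/

/-- The number of pluses of a configuration. -/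
noncomputable def plusCount (x : Config) : ℝ≥0∞ := ∑' k : ℤ, if x k = true then 1 else 0

theorem measurable_plusCount : Measurable plusCount := by
  unfold plusCount
  exact Measurable.tsum fun k =>
    Measurable.ite (measurableSet_plus k) measurable_const measurable_const

theorem lintegral_plusCount_F (α β : unitInterval) (x : Config) :
    ∫⁻ y, plusCount y ∂(F α β x) =
      ∑' k : ℤ, ENNReal.ofReal (theta α β (x k) (x (k + 1)) : ℝ) := by
  unfold plusCount
  rw [lintegral_tsum fun k => (Measurable.ite (measurableSet_plus k) measurable_const
    measurable_const).aemeasurable]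
  refine tsum_congr fun k => ?_
  rw [← F_apply_plus, ← lintegral_indicator_one (measurableSet_plus k)]
  simp [Set.indicator]

theorem plusCount_shift (x : Config) :
    ∑' k : ℤ, (if x (k + 1) = true then (1 : ℝ≥0∞) else 0) = plusCount x :=
  (Equiv.addRight (1 : ℤ)).tsum_eq fun k => if x k = true then (1 : ℝ≥0∞) else 0

/-- The number of pluses is the sum of these weights, which redistribute the mass `α` of
every plus to its left neighbour. -/
theorem tsum_redistributed (α : unitInterval) (x : Config) :
    ∑' k : ℤ, (ENNReal.ofReal (1 - α) * (if x k = true then 1 else 0) +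
      ENNReal.ofReal α * (if x (k + 1) = true then 1 else 0)) = plusCount x := by
  rw [ENNReal.tsum_add, ENNReal.tsum_mul_left, ENNReal.tsum_mul_left, plusCount_shift,
    ← plusCount, ← add_mul, ← ENNReal.ofReal_add (by linarith [α.2.2]) α.2.1]
  simp

/-- Submartingale case: the redistributed weights are dominated termwise, strictly at most at `⊕⊖`,
where `1 - α ≤ β`. -/
theorem plusCount_le_lintegral_F {α β : unitInterval} (h : 1 - (β : ℝ) ≤ α) (x : Config) :
    plusCount x ≤ ∫⁻ y, plusCount y ∂(F α β x) := by
  rw [lintegral_plusCount_F, ← tsum_redistributed α x]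
  refine ENNReal.tsum_le_tsum fun k => ?_
  cases x k <;> cases x (k + 1) <;> simp [theta]
  · exact ENNReal.ofReal_le_ofReal (by linarith)
  · rw [← ENNReal.ofReal_add (by linarith [α.2.2]) α.2.1]; simp

/-- Supermartingale case: a single right end `k` already yields the drop `1 - α - β`; all other
sites contribute a drop of at least `0`. -/
theorem lintegral_F_add_le_plusCount {α β : unitInterval} (h : (α : ℝ) < 1 - β) {x : Config}
    {k : ℤ} (h1 : x k = true) (h2 : x (k + 1) = false) :
    ENNReal.ofReal (1 - α - β) + ∫⁻ y, plusCount y ∂(F α β x) ≤ plusCount x := by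
  have hs : ∑' j : ℤ, (if j = k then ENNReal.ofReal (1 - α - β) else 0) =
      ENNReal.ofReal (1 - α - β) := tsum_ite_eq k _
  rw [lintegral_plusCount_F, ← tsum_redistributed α x, ← hs, ← ENNReal.tsum_add]
  refine ENNReal.tsum_le_tsum fun j => ?_
  by_cases hj : j = k
  · subst hj
    simp only [if_true, h1, h2, theta]
    rw [← ENNReal.ofReal_add (by linarith) β.2.1]
    simp
  · rw [if_neg hj, zero_add]
    cases x j <;> cases x (j + 1) <;> simp [theta]
    · exact ENNReal.ofReal_le_ofReal (by linarith)
    · rw [← ENNReal.ofReal_add (by linarith [α.2.2]) α.2.1]; simp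

/-! ### Bounds on the extent of the pluses -/

/-- All pluses of `x` lie in an interval of `n` consecutive sites. -/
def FitsIn (n : ℕ) (x : Config) : Prop :=
  ∃ l : ℤ, ∀ k, x k = true → l ≤ k ∧ k < l + n

theorem FitsIn.mono {m n : ℕ} (h : m ≤ n) {x : Config} (hx : FitsIn m x) : FitsIn n x := by
  obtain ⟨l, hl⟩ := hx
  exact ⟨l, fun k hk => ⟨(hl k hk).1, by have := (hl k hk).2; omega⟩⟩

/-- A new plus needs a plus at its site or just to the right, so only the left end of the interval
moves. -/
theorem FitsIn.step {n : ℕ} {x y : Config} (hx : FitsIn n x)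
    (hy : ∀ k, x k = false → x (k + 1) = false → y k = false) : FitsIn (n + 1) y := by
  obtain ⟨l, hl⟩ := hx
  refine ⟨l - 1, fun k hk => ?_⟩
  by_cases h1 : x k = true
  · have := hl k h1; push_cast; omega
  · by_cases h2 : x (k + 1) = true
    · have := hl _ h2; push_cast; omega
    · simp [hy k (by simpa using h1) (by simpa using h2)] at hk

theorem FitsIn.plusCount_le {n : ℕ} {x : Config} (hx : FitsIn n x) : plusCount x ≤ n := by
  obtain ⟨l, hl⟩ := hx
  unfold plusCount
  rw [tsum_eq_sum (s := Finset.Ico l (l + n))]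
  · refine (Finset.sum_le_sum (g := fun _ => (1 : ℝ≥0∞)) fun k _ => by split <;> simp).trans ?_
    simp
  · intro k hk
    rw [if_neg]
    exact fun h => hk (Finset.mem_Ico.2 (hl k h))

theorem FitsIn.ne_allPlus {n : ℕ} {x : Config} (hx : FitsIn n x) : x ≠ allPlus := by
  rintro rfl
  obtain ⟨l, hl⟩ := hx
  have := (hl (l - 1) rfl).1
  omega

theorem exists_plus_of_ne_allMinus {x : Config} (h : x ≠ allMinus) : ∃ k, x k = true := by
  by_contra! hc
  exact h (funext fun k => by simpa [allMinus] using hc k)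

theorem FitsIn.exists_right_end {n : ℕ} {x : Config} (hx : FitsIn n x) (h : x ≠ allMinus) :
    ∃ k, x k = true ∧ x (k + 1) = false := by
  obtain ⟨l, hl⟩ := hx
  obtain ⟨k, hk, hmax⟩ := Int.exists_greatest_of_bdd (P := fun k => x k = true)
    ⟨l + n, fun k hk => (hl k hk).2.le⟩ (exists_plus_of_ne_allMinus h)
  refine ⟨k, hk, ?_⟩
  by_contra hc
  have := hmax (k + 1) (by simpa using hc)
  omega

theorem plusCount_ne_zero {x : Config} (h : x ≠ allMinus) : plusCount x ≠ 0 := by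
  obtain ⟨k, hk⟩ := exists_plus_of_ne_allMinus h
  intro h0
  have := ENNReal.tsum_eq_zero.1 h0 k
  simp [hk] at this

theorem plusCount_allMinus : plusCount allMinus = 0 := by simp [plusCount, allMinus]

theorem fitsIn_of_length_le {n : ℕ} {x : Config} (hx : x ∈ islandsOfPluses)
    (h : length x ≤ n) : FitsIn n x := by
  by_cases hm : x = allMinus
  · subst hm; exact ⟨0, fun k hk => by simp [allMinus] at hk⟩
  have hfin : {i : ℤ | x i = true}.Finite := by
    refine Set.Finite.subset hx fun i hi => ?_
    simp only [Set.mem_ofPred_eq] at hi ⊢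
    simp [hi, allMinus]
  obtain ⟨b, hb⟩ := hfin.bddBelow
  obtain ⟨l, hl, hmin⟩ := Int.exists_least_of_bdd (P := fun k => x k = true)
    ⟨b, fun k hk => hb hk⟩ (exists_plus_of_ne_allMinus hm)
  refine ⟨l, fun k hk => ⟨hmin k hk, ?_⟩⟩
  have h1 : ((k - l + 1).toNat : ℕ∞) ≤ n :=
    le_trans (le_iSup_of_le l <| le_iSup_of_le k <| le_iSup₂_of_le (f := fun _ _ => _) hl hk
      le_rfl) h
  have h2 : (k - l + 1).toNat ≤ n := by exact_mod_cast h1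
  omega

theorem countable_islandsOfPluses : islandsOfPluses.Countable := by
  have h : islandsOfPluses ⊆ Set.range fun s : Finset ℤ => fun i : ℤ => decide (i ∈ s) := by
    intro x hx
    refine ⟨hx.toFinset, funext fun i => ?_⟩
    cases hi : x i <;> simp [hi, allMinus]
  exact (Set.countable_range _).mono h

theorem ae_fitsIn {μ : Measure Config} (hμ : IsArchipelagoOfPluses μ) (hg : giant μ < ⊤) :
    ∃ n : ℕ, ∀ᵐ x ∂μ, FitsIn n x := by
  obtain ⟨n, hn⟩ := ENat.ne_top_iff_exists.1 hg.ne
  have := hμ.1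
  refine ⟨n, ?_⟩
  have hI : ∀ᵐ x ∂μ, x ∈ islandsOfPluses :=
    (mem_ae_iff_prob_eq_one countable_islandsOfPluses.measurableSet).2 hμ.2
  -- `giant` sees only islands of positive mass; the others are countably many null points.
  have hnull : μ (islandsOfPluses ∩ {x | μ {x} = 0}) = 0 := by
    rw [← Set.biUnion_of_singleton (islandsOfPluses ∩ {x | μ {x} = 0})]
    rw [measure_biUnion_null_iff (countable_islandsOfPluses.mono Set.inter_subset_left)]
    exact fun x hx => hx.2
  have hpos : ∀ᵐ x ∂μ, x ∉ islandsOfPluses ∩ {x | μ {x} = 0} := measure_eq_zero_iff_ae_notMem.1 hnull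
  filter_upwards [hI, hpos] with x hx hx0
  refine fitsIn_of_length_le hx ?_
  rw [hn]
  refine le_iSup_of_le x <| le_iSup_of_le hx <| le_iSup_of_le ?_ le_rfl
  exact pos_iff_ne_zero.2 fun h => hx0 ⟨hx, h⟩

theorem ae_forall_fitsIn (α β : unitInterval) {μ : Measure Config} [IsProbabilityMeasure μ]
    {n : ℕ} (h : ∀ᵐ x ∂μ, FitsIn n x) :
    ∀ᵐ ω ∂(processLaw α β μ), ∀ t, FitsIn (n + t) (ω t) := by
  filter_upwards [ae_zero_of_ae α β h, ae_no_spontaneous_birth α β μ] with ω h0 hs t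
  induction t with
  | zero => exact h0
  | succ t ih => exact ih.step (hs t)

/-! ### The absorption time as the number of times spent off `allMinus` -/

theorem tau_le_tsum (ω : ℕ → Config) :
    tau ω ≤ ∑' t, ({allMinus}ᶜ : Set Config).indicator 1 (ω t) := by
  by_cases h : ∃ t, ω t = allMinus
  · classical
    have h0 := Nat.find_spec h
    calc tau ω ≤ (Nat.find h : ℝ≥0∞) :=
          iInf₂_le (f := fun (t : ℕ) (_ : ω t ∈ ({allMinus, allPlus} : Set Config)) => (t : ℝ≥0∞))
            _ (Or.inl h0)
      _ = ∑ t ∈ Finset.range (Nat.find h), ({allMinus}ᶜ : Set Config).indicator 1 (ω t) := by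
          rw [Finset.sum_congr rfl fun t ht => Set.indicator_of_mem
            (s := ({allMinus}ᶜ : Set Config)) (Nat.find_min h (Finset.mem_range.1 ht)) 1]
          simp
      _ ≤ _ := ENNReal.sum_le_tsum _
  · push Not at h
    rw [tsum_congr fun t => Set.indicator_of_mem (s := ({allMinus}ᶜ : Set Config)) (h t) 1]
    simp

/-- Once `allMinus` is absorbing, no term survives after the first visit. The opposite bound
`tau_le_tsum` needs no absorption. -/
theorem tsum_le_hittingTime {ω : ℕ → Config}
    (h : ∀ t, ω t = allMinus → ω (t + 1) = allMinus) :
    ∑' t, ({allMinus}ᶜ : Set Config).indicator (1 : Config → ℝ≥0∞) (ω t) ≤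
      hittingTime {allMinus} ω := by
  refine le_iInf₂ fun T hT => ?_
  have hT' : ∀ s, ω (T + s) = allMinus := by
    intro s
    induction s with
    | zero => exact hT
    | succ s ih => exact h _ ih
  rw [tsum_eq_sum (s := Finset.range T)]
  · refine (Finset.sum_le_sum (g := fun _ => (1 : ℝ≥0∞)) fun t _ =>
      Set.indicator_le_self _ (1 : Config → ℝ≥0∞) (ω t)).trans ?_
    simp
  · intro t ht
    obtain ⟨s, rfl⟩ := Nat.exists_eq_add_of_le (not_lt.1 fun hc => ht (Finset.mem_range.2 hc))
    simp [hT' s]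

theorem tau_eq_hittingTime_allMinus {ω : ℕ → Config} (h : ∀ t, ω t ≠ allPlus) :
    tau ω = hittingTime {allMinus} ω := by
  simp [tau, hittingTime, h]

theorem measurable_indicator_allMinus :
    Measurable (({allMinus}ᶜ : Set Config).indicator (1 : Config → ℝ≥0∞)) :=
  measurable_one.indicator (MeasurableSet.singleton _).compl

theorem tsum_inv_natCast_add_eq_top (n : ℕ) :
    ∑' t : ℕ, (((n + 1 + t : ℕ) : ℝ≥0∞))⁻¹ = ⊤ := by
  by_contra h
  have h1 : ∀ t : ℕ, (((n + 1 + t : ℕ) : ℝ≥0∞))⁻¹ = (((((n + 1 + t : ℕ) : NNReal))⁻¹ : NNReal) : ℝ≥0∞) := by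
    intro t
    rw [ENNReal.coe_inv (by positivity)]
    simp
  simp only [h1] at h
  rw [← ne_eq, ENNReal.tsum_coe_ne_top_iff_summable, ← NNReal.summable_coe] at h
  refine Real.not_summable_natCast_inv ((summable_nat_add_iff (n + 1)).1 ?_)
  refine h.congr fun t => ?_
  push_cast
  ring

/-! ### The two regimes -/

theorem expectedTau_lt_top {α β : unitInterval} (hαβ : (α : ℝ) < 1 - β) {μ : Measure Config}
    [IsProbabilityMeasure μ] {n : ℕ} (h : ∀ᵐ x ∂μ, FitsIn n x) : expectedTau α β μ < ⊤ := by
  set P := processLaw α β μ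
  set c := ENNReal.ofReal (1 - α - β) with hc
  have hc0 : c ≠ 0 := by simp [hc]; linarith
  let p : ℕ → ℝ≥0∞ := fun t => ∫⁻ ω, ({allMinus}ᶜ : Set Config).indicator 1 (ω t) ∂P
  let e : ℕ → ℝ≥0∞ := fun t => ∫⁻ ω, plusCount (ω t) ∂P
  have hfit := ae_forall_fitsIn α β h
  have hdrift : ∀ t, c * p t + e (t + 1) ≤ e t := by
    intro t
    have he : e (t + 1) = ∫⁻ ω, ∫⁻ y, plusCount y ∂(F α β (ω t)) ∂P :=
      lintegral_consecutive α β μ t (g := fun q => plusCount q.2)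
        (measurable_plusCount.comp measurable_snd)
    have hm : Measurable fun ω : ℕ → Config =>
        ({allMinus}ᶜ : Set Config).indicator (1 : Config → ℝ≥0∞) (ω t) :=
      measurable_indicator_allMinus.comp (measurable_pi_apply t)
    rw [he, ← lintegral_const_mul _ hm, ← lintegral_add_left (hm.const_mul c)]
    refine lintegral_mono_ae ?_
    filter_upwards [hfit] with ω hω
    by_cases hz : ω t = allMinus
    · simp [hz, lintegral_plusCount_F, allMinus, theta]
    · obtain ⟨k, h1, h2⟩ := (hω t).exists_right_end hz
      simpa [hz] using lintegral_F_add_le_plusCount hαβ h1 h2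
  -- Telescoped drift; `e T` is kept on the left to avoid subtraction in `ℝ≥0∞`.
  have hsum : ∀ T, c * ∑ t ∈ Finset.range T, p t + e T ≤ e 0 := by
    intro T
    induction T with
    | zero => simp
    | succ T ih =>
      rw [Finset.sum_range_succ, mul_add, add_assoc]
      exact (add_le_add le_rfl (hdrift T)).trans ih
  have he0 : e 0 ≤ n := by
    calc e 0 ≤ ∫⁻ _, (n : ℝ≥0∞) ∂P := by
          refine lintegral_mono_ae ?_
          filter_upwards [hfit] with ω hω
          exact (hω 0).plusCount_le
      _ = n := by simp [P]
  have hT : ∑' t, p t ≤ e 0 / c := by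
    refine ENNReal.tsum_le_of_sum_range_le fun T => ?_
    rw [ENNReal.le_div_iff_mul_le (Or.inl hc0) (Or.inl ENNReal.ofReal_ne_top), mul_comm]
    exact le_self_add.trans (hsum T)
  calc expectedTau α β μ
      ≤ ∫⁻ ω, ∑' t, ({allMinus}ᶜ : Set Config).indicator 1 (ω t) ∂P :=
        lintegral_mono tau_le_tsum
    _ = ∑' t, p t := lintegral_tsum fun t =>
        (measurable_indicator_allMinus.comp (measurable_pi_apply t)).aemeasurable
    _ ≤ e 0 / c := hT
    _ < ⊤ := ENNReal.div_lt_top (he0.trans_lt (ENNReal.natCast_lt_top n)).ne hc0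

theorem expectedTau_eq_top {α β : unitInterval} (hαβ : 1 - (β : ℝ) ≤ α) {μ : Measure Config}
    [IsProbabilityMeasure μ] {n : ℕ} (h : ∀ᵐ x ∂μ, FitsIn n x) (hμ : μ ≠ Measure.dirac allMinus) :
    expectedTau α β μ = ⊤ := by
  set P := processLaw α β μ
  let p : ℕ → ℝ≥0∞ := fun t => ∫⁻ ω, ({allMinus}ᶜ : Set Config).indicator 1 (ω t) ∂P
  let e : ℕ → ℝ≥0∞ := fun t => ∫⁻ ω, plusCount (ω t) ∂P
  -- Widening to `n + 1` keeps the denominators `n + 1 + t` positive.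
  have hfit := ae_forall_fitsIn α β (h.mono fun x hx => hx.mono n.le_succ)
  have hmono : Monotone e := by
    refine monotone_nat_of_le_succ fun t => ?_
    have he : e (t + 1) = ∫⁻ ω, ∫⁻ y, plusCount y ∂(F α β (ω t)) ∂P :=
      lintegral_consecutive α β μ t (g := fun q => plusCount q.2)
        (measurable_plusCount.comp measurable_snd)
    rw [he]
    exact lintegral_mono fun ω => plusCount_le_lintegral_F hαβ (ω t)
  have he0 : e 0 ≠ 0 := by
    intro h0
    have h1 : e 0 = ∫⁻ x, plusCount x ∂μ := by
      conv_rhs => rw [← processLaw_map_zero α β μ]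
      rw [lintegral_map measurable_plusCount (by fun_prop)]
    rw [h1, lintegral_eq_zero_iff measurable_plusCount] at h0
    have h2 : ∀ᵐ x ∂μ, x = allMinus := by
      filter_upwards [h0] with x hx
      by_contra hc
      exact plusCount_ne_zero hc hx
    apply hμ
    have h3 : μ.map id = μ.map fun _ => allMinus := Measure.map_congr h2
    rw [Measure.map_id, Measure.map_const, measure_univ, one_smul] at h3
    exact h3
  have hep : ∀ t, e t ≤ ((n + 1 + t : ℕ) : ℝ≥0∞) * p t := by
    intro t
    have hm : Measurable fun ω : ℕ → Config =>
        ({allMinus}ᶜ : Set Config).indicator (1 : Config → ℝ≥0∞) (ω t) :=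
      measurable_indicator_allMinus.comp (measurable_pi_apply t)
    rw [← lintegral_const_mul _ hm]
    refine lintegral_mono_ae ?_
    filter_upwards [hfit] with ω hω
    by_cases hz : ω t = allMinus
    · simp [hz, plusCount_allMinus]
    · simpa [hz] using (hω t).plusCount_le
  have hp : ∀ t, e 0 * (((n + 1 + t : ℕ) : ℝ≥0∞))⁻¹ ≤ p t := by
    intro t
    rw [← div_eq_mul_inv]
    exact ENNReal.div_le_of_le_mul' ((hmono (Nat.zero_le t)).trans (hep t))
  rw [eq_top_iff]
  calc ⊤ = e 0 * ∑' t : ℕ, (((n + 1 + t : ℕ) : ℝ≥0∞))⁻¹ := by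
        rw [tsum_inv_natCast_add_eq_top, ENNReal.mul_top he0]
    _ = ∑' t : ℕ, e 0 * (((n + 1 + t : ℕ) : ℝ≥0∞))⁻¹ := ENNReal.tsum_mul_left.symm
    _ ≤ ∑' t, p t := ENNReal.tsum_le_tsum hp
    _ = ∫⁻ ω, ∑' t, ({allMinus}ᶜ : Set Config).indicator 1 (ω t) ∂P :=
        (lintegral_tsum fun t =>
          (measurable_indicator_allMinus.comp (measurable_pi_apply t)).aemeasurable).symm
    _ ≤ expectedTau α β μ := by
        refine lintegral_mono_ae ?_
        filter_upwards [hfit, ae_no_spontaneous_birth α β μ] with ω hω hs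
        rw [tau_eq_hittingTime_allMinus fun t => (hω t).ne_allPlus]
        refine tsum_le_hittingTime fun t ht => funext fun k => ?_
        exact hs t k (by simp [ht, allMinus]) (by simp [ht, allMinus])

end Archipelago

open Archipelago
theorem theorem2 (α β : unitInterval) (hβ : (β : ℝ) < 1)
    (μ : Measure Config) (hμ : IsArchipelagoOfPluses μ) (hgiant : giant μ < ⊤) :
    (∀ᵐ ω ∂(processLaw α β μ), tau ω = hittingTime {allMinus} ω) ∧
    ((α : ℝ) < 1 - (β : ℝ) → expectedTau α β μ < ⊤) ∧
    (1 - (β : ℝ) ≤ (α : ℝ) → μ ≠ Measure.dirac allMinus → expectedTau α β μ = ⊤) := by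
  have := hμ.1
  obtain ⟨n, hn⟩ := ae_fitsIn hμ hgiant
  refine ⟨?_, fun h => expectedTau_lt_top h hn, fun h h' => expectedTau_eq_top h hn h'⟩
  filter_upwards [ae_forall_fitsIn α β hn] with ω hω
  exact tau_eq_hittingTime_allMinus fun t => (hω t).ne_allPlus
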